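/- Let $k$ be an algebraically closed field and let $V$ be a non-empty separated $k$-scheme of finite type (for instance a variety) with an action of $\mathbb{G}_m$. Assume that $V$ is nearly projective: $V$ is projective over its affinization $V_0=\mathrm{Spec}\,\Gamma(V,\mathcal O_V)$, and $\Gamma(V,\mathcal O_V)$ has only non-negative $\mathbb{G}_m$-weights, its part of weight zero being $k$ (so $\mathbb{G}_m$ retracts $V_0$ to a unique fixed point). Let $E_1,\dots,E_n$ be $\mathbb{G}_m$-equivariant vector bundles on $V$, of ranks $\alpha_1,\dots,\alpha_n$, forming a decent collection: $\Gamma(V,\mathcal O_V)\to\mathrm{End}(E_i)$ is an isomorphism for every $i$, and $\mathbb{G}_m$ acts on $\mathrm{Hom}(E_i,E_j)$ with non-negative weights for all $i,j$, and with positive weights if $j<i$. Assume that at least one of the ranks $\alpha_i$ is non-zero in $k$ (automatic if $\mathrm{char}\,k=0$ and $n\ge 1$). Let $A=\mathrm{End}(\bigoplus_i E_i)^{\mathrm{op}}$, graded by placing the weight-$r$ part of $\mathrm{Hom}(E_i,E_j)$ in degree $j-i+nr$, and let $\mathbf Q$ be a Bondal quiver of the collection: its nodes are $1,\dots,n$,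 its arrows from $i$ to $j$ are homogeneous elements of positive degree in $\mathrm{Hom}(E_j,E_i)$ whose classes form a basis of the corresponding component of $A_+/A_+^2$ (the dual of $\mathrm{Ext}^1_A(S_i,S_j)$, where $S_i$ is the one-dimensional simple module at the node $i$), and its relations are the linear combinations of paths that vanish in $A$. Let $R_\alpha(\mathbf Q)$ be the affine scheme of representations of $\mathbf Q$ in which the node $i$ is sent to $k^{\alpha_i}$, let $B$ be its coordinate ring, let $G=\prod_i \mathrm{GL}(\alpha_i)/\mathbb{G}_m$ act on it by change of bases, and put $M_0=\mathrm{Spec}\,B^G$. The family of representations $\bigoplus_i E_i^\vee$ over $V$ defines the tautological map $T:V\to[R_\alpha(\mathbf Q)/G]$, and pulling back functions along $T$ gives a well-defined ring homomorphism $T^*:B^G\to\Gamma(V,\mathcal O_V)$: over an open set on which all the $E_i$ are trivialized, $T^*$ evaluates an invariant function at the matrices by which the arrows act in the dual frames, and this determines $T^*$ uniquely. Let $\varphi_0=\mathrm{Spec}(T^*):V_0\to M_0$. Then $\varphi_0$ is a closed embedding; equivalently, $T^*:B^G\to\Gamma(V,\mathcal O_V)$ is surjective. -/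

import Mathlib

open CategoryTheory AlgebraicGeometry TopologicalSpace

universe u

noncomputable section

namespace Bondal

/-! ## Scalars acting on morphisms of sheaves of modules -/

section Scalars

variable {X : Scheme.{u}}

/-- Multiplication by a global function `c`, as an endomorphism of an `𝒪`-module. -/
def scalarEnd (M : X.Modules) (c : Γ(X, ⊤)) : M ⟶ M :=
  SheafOfModules.Hom.mk
    { app := fun U => ModuleCat.ofHom
        { toFun := fun (x : Γ(M, U.unop)) =>
            (X.presheaf.map (homOfLE (le_top : U.unop ≤ ⊤)).op c : Γ(X, U.unop)) • x
          map_add' := fun x y => smul_add (A := Γ(M, U.unop)) _ x y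
          map_smul' := fun (r : Γ(X, U.unop)) (x : Γ(M, U.unop)) => smul_comm _ r x }
      naturality := by
        intro U W f
        ext (x : Γ(M, U.unop))
        obtain ⟨f, rfl⟩ : ∃ g : W.unop ⟶ U.unop, f = g.op := ⟨f.unop, rfl⟩
        have h : X.presheaf.map f.op (X.presheaf.map (homOfLE (le_top : U.unop ≤ ⊤)).op c) =
            X.presheaf.map (homOfLE (le_top : W.unop ≤ ⊤)).op c := by
          rw [← CommRingCat.comp_apply, ← Functor.map_comp]
          rfl
        have := M.map_smul f (X.presheaf.map (homOfLE (le_top : U.unop ≤ ⊤)).op c) x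
        rw [h] at this
        exact this.symm }

@[simp]
lemma scalarEnd_app (M : X.Modules) (c : Γ(X, ⊤)) (U : X.Opens) (x : Γ(M, U)) :
    (scalarEnd M c).app U x =
      (X.presheaf.map (homOfLE (le_top : U ≤ ⊤)).op c : Γ(X, U)) • x := rfl

/-- The ring homomorphism `Γ(X, 𝒪) → End(M)`. -/
def scalarHom (M : X.Modules) : Γ(X, ⊤) →+* End M where
  toFun := scalarEnd M
  map_one' := by
    apply Scheme.Modules.hom_ext
    intro U
    ext x
    erw [scalarEnd_app]
    simp
  map_zero' := by
    apply Scheme.Modules.hom_ext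
    intro U
    ext x
    erw [scalarEnd_app]
    simp
  map_add' a b := by
    apply Scheme.Modules.hom_ext
    intro U
    ext x
    erw [Scheme.Modules.Hom.add_app]
    erw [scalarEnd_app]
    simp [add_smul]
  map_mul' a b := by
    apply Scheme.Modules.hom_ext
    intro U
    ext x
    rw [End.mul_def]
    erw [scalarEnd_app]
    erw [Scheme.Modules.Hom.comp_app, AddCommGrpCat.comp_apply, scalarEnd_app, scalarEnd_app]
    simp only [map_mul, mul_smul]

/-- The structure map `k → Γ(X, U)` of a scheme over `Spec k`. -/
def constants (k : Type u) [Field k] (X : Scheme.{u}) [X.Over (Spec (.of k))] (U : X.Opens) :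
    k →+* Γ(X, U) :=
  ((Scheme.ΓSpecIso (.of k)).inv ≫ (X ↘ Spec (.of k)).appTop ≫
    X.presheaf.map (homOfLE (le_top : U ≤ ⊤)).op).hom

/-- For `X` over `Spec k`, the groups `Hom(M, N)` are `k`-vector spaces. -/
instance homModule {k : Type u} [Field k] [X.Over (Spec (.of k))] (M N : X.Modules) :
    Module k (M ⟶ N) :=
  Module.compHom (M ⟶ N) ((scalarHom N).comp (constants k X ⊤))

end Scalars

/-! ## `𝔾ₘ`-actions, equivariant sheaves, weights -/

section Actions

/-- An action of `𝔾ₘ` on a `k`-scheme `V`, through its functor of points: for every `k`-scheme `T`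
the group `𝔾ₘ(T) = Γ(T, 𝒪)ˣ` acts on the set of `T`-points of `V` over `k`, naturally in `T`.
(A morphism `x : T ⟶ V` makes `T` a `k`-scheme.) -/
structure GmAction (k : Type u) [Field k] (V : Scheme.{u}) [V.Over (Spec (.of k))] where
  act {T : Scheme.{u}} (t : Γ(T, ⊤)ˣ) (x : T ⟶ V) : T ⟶ V
  act_over {T : Scheme.{u}} (t : Γ(T, ⊤)ˣ) (x : T ⟶ V) :
    act t x ≫ (V ↘ Spec (.of k)) = x ≫ (V ↘ Spec (.of k))
  comp_act {T T' : Scheme.{u}} (f : T' ⟶ T) (t : Γ(T, ⊤)ˣ) (x : T ⟶ V) :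
    f ≫ act t x = act (Units.map f.appTop.hom.toMonoidHom t) (f ≫ x)
  one_act {T : Scheme.{u}} (x : T ⟶ V) : act 1 x = x
  mul_act {T : Scheme.{u}} (s t : Γ(T, ⊤)ˣ) (x : T ⟶ V) : act (s * t) x = act s (act t x)

variable {k : Type u} [Field k] {V : Scheme.{u}} [V.Over (Spec (.of k))]

/-- A `𝔾ₘ`-equivariant structure on an `𝒪_V`-module `E`: for all points `t` of `𝔾ₘ` and `x` of `V`
with values in `T`, an isomorphism `(t·x)^* E ≅ x^* E`, compatible with base change in `T` and
satisfying the cocycle condition. -/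
structure EquivariantStructure (σ : GmAction k V) (E : V.Modules) where
  iso {T : Scheme.{u}} (t : Γ(T, ⊤)ˣ) (x : T ⟶ V) :
    (Scheme.Modules.pullback (σ.act t x)).obj E ≅ (Scheme.Modules.pullback x).obj E
  base_change {T T' : Scheme.{u}} (f : T' ⟶ T) (t : Γ(T, ⊤)ˣ) (x : T ⟶ V) :
    (Scheme.Modules.pullback f).map (iso t x).hom ≫
        (Scheme.Modules.pullbackComp f x).hom.app E =
      (Scheme.Modules.pullbackComp f (σ.act t x)).hom.app E ≫
        (Scheme.Modules.pullbackCongr (σ.comp_act f t x)).hom.app E ≫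
          (iso (Units.map f.appTop.hom.toMonoidHom t) (f ≫ x)).hom
  cocycle {T : Scheme.{u}} (s t : Γ(T, ⊤)ˣ) (x : T ⟶ V) :
    (iso (s * t) x).hom =
      (Scheme.Modules.pullbackCongr (σ.mul_act s t x)).hom.app E ≫
        (iso s (σ.act t x)).hom ≫ (iso t x).hom

/-- A global function `f` has weight `r` if `f(t·x) = t ^ r f(x)`. -/
def FunctionHasWeight (σ : GmAction k V) (r : ℤ) (f : Γ(V, ⊤)) : Prop :=
  ∀ ⦃T : Scheme.{u}⦄ (t : Γ(T, ⊤)ˣ) (x : T ⟶ V),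
    (σ.act t x).appTop f = ((t ^ r : Γ(T, ⊤)ˣ) : Γ(T, ⊤)) * x.appTop f

/-- A morphism `f : M ⟶ N` of equivariant sheaves has weight `r` if, under the equivariant
structures, its pullback along `t·x` is `t ^ r` times its pullback along `x`. -/
def HasWeight {σ : GmAction k V} {M N : V.Modules} (φ : EquivariantStructure σ M)
    (ψ : EquivariantStructure σ N) (r : ℤ) (f : M ⟶ N) : Prop :=
  ∀ ⦃T : Scheme.{u}⦄ (t : Γ(T, ⊤)ˣ) (x : T ⟶ V),
    (Scheme.Modules.pullback (σ.act t x)).map f ≫ (ψ.iso t x).hom =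
      (φ.iso t x).hom ≫ (Scheme.Modules.pullback x).map f ≫
        scalarEnd _ ((t ^ r : Γ(T, ⊤)ˣ) : Γ(T, ⊤))

attribute [local instance] MvPolynomial.gradedAlgebra

/-- `V` is nearly projective: `V` is a separated `k`-scheme of finite type, projective over its
affinization `V₀ = Spec Γ(V, 𝒪)`, and `𝔾ₘ` retracts `V₀` to a unique fixed point.  The last
condition says algebraically that `Γ(V, 𝒪)` is graded by non-negative weights, its part of
weight zero being `k`. -/
structure NearlyProjective (σ : GmAction k V) : Prop where
  nonempty : Nonempty V
  separated : IsSeparated (V ↘ Spec (.of k))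
  finiteType : LocallyOfFiniteType (V ↘ Spec (.of k))
  quasiCompact : QuasiCompact (V ↘ Spec (.of k))
  projective : ∃ (N : ℕ)
    (i : V ⟶ Proj (MvPolynomial.homogeneousSubmodule (Fin (N + 1)) Γ(V, ⊤))),
    IsClosedImmersion i ∧
      i ≫ Proj.toSpecZero (MvPolynomial.homogeneousSubmodule (Fin (N + 1)) Γ(V, ⊤)) ≫
        Spec.map (CommRingCat.ofHom (algebraMap Γ(V, ⊤)
          (MvPolynomial.homogeneousSubmodule (Fin (N + 1)) Γ(V, ⊤) 0))) = V.toSpecΓ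
  nonneg : AddSubgroup.closure {f : Γ(V, ⊤) | ∃ r : ℤ, 0 ≤ r ∧ FunctionHasWeight σ r f} = ⊤
  weight_zero : ∀ f : Γ(V, ⊤), FunctionHasWeight σ 0 f ↔ f ∈ Set.range (constants k V ⊤)

end Actions

/-! ## Vector bundles and decent collections -/

section Bundles

variable {k : Type u} [Field k] {V : Scheme.{u}} [V.Over (Spec (.of k))]

/-- The sections `e p` of `E` over `U` form a frame, i.e. they define an isomorphism
`𝒪_U ^ r ≅ E|_U`. -/
def IsFrame (E : V.Modules) (U : V.Opens) {r : ℕ} (e : Fin r → Γ(E, U)) : Prop :=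
  ∀ (W : V.Opens) (h : W ≤ U),
    Function.Bijective fun c : Fin r → Γ(V, W) =>
      ∑ p, c p • (E.presheaf.map (homOfLE h).op (e p) : Γ(E, W))

/-- `E` is a vector bundle of rank `r`. -/
def IsVectorBundle (E : V.Modules) (r : ℕ) : Prop :=
  ∀ x : V, ∃ (U : V.Opens) (e : Fin r → Γ(E, U)), x ∈ U ∧ IsFrame E U e

variable {n : ℕ} {σ : GmAction k V} {E : Fin n → V.Modules}

/-- A collection `E₁, …, Eₙ` of equivariant vector bundles is decent if the natural maps
`Γ(V, 𝒪) → End(Eᵢ)` are isomorphisms, `𝔾ₘ` acts on `Hom(Eᵢ, Eⱼ)` with non-negative weights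
(i.e. this space is spanned by vectors of non-negative weight), and with positive weights
if `j < i`. -/
structure Decent (φ : ∀ i, EquivariantStructure σ (E i)) : Prop where
  endo : ∀ i, Function.Bijective (scalarHom (E i))
  nonneg : ∀ i j, Submodule.span k
    {f : E i ⟶ E j | ∃ r : ℤ, 0 ≤ r ∧ HasWeight (φ i) (φ j) r f} = ⊤
  pos : ∀ i j, j < i → Submodule.span k
    {f : E i ⟶ E j | ∃ r : ℤ, 0 < r ∧ HasWeight (φ i) (φ j) r f} = ⊤

/-- The algebra `A = End(⊕ Eᵢ)ᵒᵖ = ⊕ Hom(Eᵢ, Eⱼ)` is graded, with `f : Eᵢ ⟶ Eⱼ` of weight `r`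
placed in degree `j - i + n r`.  This is the predicate that `f` is homogeneous of degree `d`. -/
def HasDegree (φ : ∀ i, EquivariantStructure σ (E i)) {i j : Fin n} (d : ℤ)
    (f : E i ⟶ E j) : Prop :=
  ∃ r : ℤ, d = (j : ℤ) - (i : ℤ) + n * r ∧ HasWeight (φ i) (φ j) r f

/-- The part of `A₊` (spanned by the elements of positive degree) in `Hom(Eᵢ, Eⱼ)`. -/
def posPart (φ : ∀ i, EquivariantStructure σ (E i)) (i j : Fin n) :
    Submodule k (E i ⟶ E j) :=
  Submodule.span k {f | ∃ d : ℤ, 0 < d ∧ HasDegree φ d f}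

/-- The part of `(A₊)²` in `Hom(Eᵢ, Eⱼ)`. -/
def posPartSq (φ : ∀ i, EquivariantStructure σ (E i)) (i j : Fin n) :
    Submodule k (E i ⟶ E j) :=
  Submodule.span k {f | ∃ (l : Fin n) (g : E i ⟶ E l) (h : E l ⟶ E j),
    g ∈ posPart φ i l ∧ h ∈ posPart φ l j ∧ f = g ≫ h}

end Bundles

/-! ## Quivers with relations, their representation spaces, and invariants -/

section Quivers

/-- Paths from one node to another in the directed graph on `{1, …, n}` with arrows `Arr i j` from
`i` to `j`. -/
inductive QPath {n : ℕ} (Arr : Fin n → Fin n → Type u) (i : Fin n) : Fin n → Type u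
  | nil : QPath Arr i i
  | cons {j l : Fin n} (p : QPath Arr i j) (a : Arr j l) : QPath Arr i l

/-- A directed graph on `n` nodes, with relations: `rel i j` consists of linear combinations of
paths from `i` to `j`. -/
structure QuiverWithRelations (k : Type u) [Field k] (n : ℕ) where
  Arr : Fin n → Fin n → Type u
  rel : ∀ i j, Submodule k (QPath Arr i j →₀ k)

variable {n : ℕ} {Arr : Fin n → Fin n → Type u}

/-- The matrix by which a path acts, when the arrows act by the matrices `M a`
(on column vectors). -/
def pathMatrix {S : Type*} [CommRing S] {α : Fin n → ℕ}
    (M : ∀ i j, Arr i j → Matrix (Fin (α j)) (Fin (α i)) S) {i : Fin n} :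
    ∀ {j : Fin n}, QPath Arr i j → Matrix (Fin (α j)) (Fin (α i)) S
  | _, .nil => 1
  | _, .cons p a => M _ _ a * pathMatrix M p

variable {k : Type u} [Field k]

namespace QuiverWithRelations

variable (Q : QuiverWithRelations k n) (α : Fin n → ℕ)

/-- The matrix entries of the arrows: coordinates on the affine space
`∏ Hom(k ^ αᵢ, k ^ αⱼ)`. -/
structure Coord : Type u where
  i : Fin n
  j : Fin n
  a : Q.Arr i j
  p : Fin (α j)
  q : Fin (α i)

/-- The generic matrices. -/
def generic (i j : Fin n) (a : Q.Arr i j) :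
    Matrix (Fin (α j)) (Fin (α i)) (MvPolynomial (Q.Coord α) k) :=
  Matrix.of fun p q => MvPolynomial.X ⟨i, j, a, p, q⟩

/-- The matrix entries of the relations. -/
def relEntry {i j : Fin n} (ρ : QPath Q.Arr i j →₀ k) :
    Matrix (Fin (α j)) (Fin (α i)) (MvPolynomial (Q.Coord α) k) :=
  ρ.sum fun π c => c • pathMatrix (Q.generic α) π

/-- The ideal of the affine scheme `R_α(Q)`, generated by the matrix entries of the relations. -/
def relIdeal : Ideal (MvPolynomial (Q.Coord α) k) :=
  Ideal.span {P | ∃ (i j : Fin n) (ρ : QPath Q.Arr i j →₀ k) (p : Fin (α j)) (q : Fin (α i)),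
    ρ ∈ Q.rel i j ∧ P = Q.relEntry α ρ p q}

/-- The affine coordinate ring `B` of the space `R_α(Q)` of representations of `Q` in which the
node `i` is sent to `k ^ αᵢ`. -/
abbrev CoordRing : Type u := MvPolynomial (Q.Coord α) k ⧸ Q.relIdeal α

variable {α} in
/-- An invertible matrix over `k`, viewed over the polynomial ring. -/
def constMatrix {i : Fin n} (g : GL (Fin (α i)) k) :
    Matrix (Fin (α i)) (Fin (α i)) (MvPolynomial (Q.Coord α) k) :=
  Matrix.of fun p q => MvPolynomial.C ((g : Matrix (Fin (α i)) (Fin (α i)) k) p q)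

/-- The substitution `X_a ↦ g_j⁻¹ X_a g_i` (for `a` from `i` to `j`) on polynomial functions, for
`g ∈ ∏ GL(αᵢ)`. It is `P ↦ P(g⁻¹ · -)`, where `g` acts on representations by
`X_a ↦ g_j X_a g_i⁻¹`. -/
def polyAct (g : ∀ i, GL (Fin (α i)) k) :
    MvPolynomial (Q.Coord α) k →ₐ[k] MvPolynomial (Q.Coord α) k :=
  MvPolynomial.aeval fun x =>
    (Q.constMatrix (g x.j)⁻¹ * Q.generic α x.i x.j x.a * Q.constMatrix (g x.i)) x.p x.q

variable {α}

lemma constMatrix_mul {i : Fin n} (g h : GL (Fin (α i)) k) :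
    Q.constMatrix g * Q.constMatrix h = Q.constMatrix (g * h) := by
  apply Matrix.ext
  intro p q
  simp [constMatrix, Matrix.mul_apply]

lemma constMatrix_one {i : Fin n} : Q.constMatrix (1 : GL (Fin (α i)) k) = 1 := by
  apply Matrix.ext
  intro p q
  by_cases h : p = q
  · subst h
    simp [constMatrix]
  · simp [constMatrix, Matrix.one_apply_ne h]

lemma polyAct_path (g : ∀ i, GL (Fin (α i)) k) (i j : Fin n) (π : QPath Q.Arr i j) :
    (pathMatrix (Q.generic α) π).map (Q.polyAct α g) =
      Q.constMatrix (g j)⁻¹ * pathMatrix (Q.generic α) π * Q.constMatrix (g i) := by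
  induction π with
  | nil =>
    simp only [pathMatrix]
    rw [Matrix.map_one _ (map_zero _) (map_one _), mul_one, constMatrix_mul, inv_mul_cancel,
      constMatrix_one]
  | @cons j l π a ih =>
    have hgen : (Q.generic α j l a).map (Q.polyAct α g) =
        Q.constMatrix (g l)⁻¹ * Q.generic α j l a * Q.constMatrix (g j) := by
      apply Matrix.ext
      intro p q
      simp [polyAct, generic]
    simp only [pathMatrix]
    rw [Matrix.map_mul, ih, hgen]
    have key : Q.constMatrix (g j) * Q.constMatrix (g j)⁻¹ = 1 := by
      rw [constMatrix_mul, mul_inv_cancel, constMatrix_one]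
    calc _ = Q.constMatrix (g l)⁻¹ * Q.generic α j l a *
          (Q.constMatrix (g j) * Q.constMatrix (g j)⁻¹) *
          pathMatrix (Q.generic α) π * Q.constMatrix (g i) := by
            simp only [Matrix.mul_assoc]
      _ = _ := by rw [key]; simp only [Matrix.mul_assoc, Matrix.one_mul]

lemma polyAct_rel (g : ∀ i, GL (Fin (α i)) k) {i j : Fin n} (ρ : QPath Q.Arr i j →₀ k) :
    (Q.relEntry α ρ).map (Q.polyAct α g) =
      Q.constMatrix (g j)⁻¹ * Q.relEntry α ρ * Q.constMatrix (g i) := by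
  have h : (Q.relEntry α ρ).map (Q.polyAct α g) =
      ρ.sum fun π c => c • (pathMatrix (Q.generic α) π).map (Q.polyAct α g) := by
    apply Matrix.ext
    intro p q
    simp [relEntry, Finsupp.sum, Matrix.sum_apply, map_sum]
  rw [h]
  simp only [polyAct_path, relEntry, Finsupp.sum, Matrix.mul_sum, Matrix.sum_mul,
    Matrix.mul_smul, Matrix.smul_mul]

variable (α)

lemma relIdeal_le_comap (g : ∀ i, GL (Fin (α i)) k) :
    Q.relIdeal α ≤ (Q.relIdeal α).comap (Q.polyAct α g) := by
  rw [relIdeal, Ideal.span_le]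
  rintro _ ⟨i, j, ρ, p, q, hρ, rfl⟩
  rw [SetLike.mem_coe, Ideal.mem_comap]
  have h : Q.polyAct α g (Q.relEntry α ρ p q) = (Q.relEntry α ρ).map (Q.polyAct α g) p q := rfl
  rw [h, polyAct_rel, Matrix.mul_apply]
  refine Ideal.sum_mem _ fun q' _ => Ideal.mul_mem_right _ _ ?_
  rw [Matrix.mul_apply]
  exact Ideal.sum_mem _ fun p' _ => Ideal.mul_mem_left _ _
    (Ideal.subset_span ⟨i, j, ρ, p', q', hρ, rfl⟩)

/-- The induced action of `∏ GL(αᵢ)` on `B`. -/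
def ringAct (g : ∀ i, GL (Fin (α i)) k) : Q.CoordRing α →ₐ[k] Q.CoordRing α :=
  Ideal.quotientMapₐ (Q.relIdeal α) (Q.polyAct α g) (Q.relIdeal_le_comap α g)

/-- The ring of invariants `B ^ G`, where `G = ∏ GL(αᵢ) / 𝔾ₘ`; the diagonal `𝔾ₘ` acts trivially,
so that the functions invariant under `G` are those invariant under `∏ GL(αᵢ)`. -/
def invariants : Subalgebra k (Q.CoordRing α) :=
  ⨅ g : ∀ i, GL (Fin (α i)) k, AlgHom.equalizer (Q.ringAct α g) (AlgHom.id k (Q.CoordRing α))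

end QuiverWithRelations

end Quivers

/-! ## The Bondal quiver and the tautological map -/

section BondalQuiver

variable {k : Type u} [Field k] {V : Scheme.{u}} [V.Over (Spec (.of k))]
  {n : ℕ} {σ : GmAction k V} {E : Fin n → V.Modules}

/-- The morphism attached to a path, when an arrow from `i` to `j` is sent to a morphism
`E j ⟶ E i` (multiplication in `A = End(⊕ Eᵢ)ᵒᵖ`). -/
def pathHom {Arr : Fin n → Fin n → Type u} (hom : ∀ i j, Arr i j → (E j ⟶ E i)) {i : Fin n} :
    ∀ {j : Fin n}, QPath Arr i j → (E j ⟶ E i)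
  | _, .nil => 𝟙 _
  | _, .cons p a => hom _ _ a ≫ pathHom hom p

/-- The data of a Bondal quiver of the collection `E₁, …, Eₙ`.  The arrows from `i` to `j` are
homogeneous elements of `A` of positive degree in `Hom(Eⱼ, Eᵢ)` that form a basis of
`(A₊ / A₊²)` there, which is the dual of `Ext¹_A(Sᵢ, Sⱼ)`. -/
structure BondalQuiver (φ : ∀ i, EquivariantStructure σ (E i)) where
  Arr : Fin n → Fin n → Type u
  hom : ∀ i j, Arr i j → (E j ⟶ E i)
  homogeneous : ∀ i j (a : Arr i j), ∃ d : ℤ, 0 < d ∧ HasDegree φ d (hom i j a)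
  linearIndependent : ∀ i j,
    LinearIndependent k fun a : Arr i j => (posPartSq φ j i).mkQ (hom i j a)
  span : ∀ i j,
    Submodule.span k (Set.range (hom i j)) ⊔ posPartSq φ j i = posPart φ j i

variable {φ : ∀ i, EquivariantStructure σ (E i)}

namespace BondalQuiver

variable (Q : BondalQuiver φ) (α : Fin n → ℕ)

/-- The Bondal quiver as a quiver with relations: the relations are the linear combinations of paths
that vanish in `A`. -/
def toQuiver : QuiverWithRelations k n where
  Arr := Q.Arr
  rel _ _ := LinearMap.ker (Finsupp.linearCombination k (pathHom Q.hom))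

/-- `IsTautologicalPullback τ` says that `τ : B ^ G → Γ(V, 𝒪)` is the pullback of functions along the
tautological map `T : V → [R_α(Q) / G]`, which is given by the family of representations
`⊕ Eᵢ^∨`: over any open `U` on which frames of all `Eᵢ` are given, an arrow `a` from `i` to `j`
acts in the dual frames by a matrix `M a`, and the pullback of an invariant function is obtained
by evaluating it at these matrices. -/
def IsTautologicalPullback (τ : Q.toQuiver.invariants α →+* Γ(V, ⊤)) : Prop :=
  ∀ (U : V.Opens) (e : ∀ i, Fin (α i) → Γ(E i, U)), (∀ i, IsFrame (E i) U (e i)) →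
  ∀ M : ∀ i j, Q.Arr i j → Matrix (Fin (α j)) (Fin (α i)) Γ(V, U),
    (∀ i j (a : Q.Arr i j) (p : Fin (α j)),
      (Q.hom i j a).app U (e j p) = ∑ q, M i j a p q • e i q) →
  ∀ (P : MvPolynomial (Q.toQuiver.Coord α) k)
    (hP : Ideal.Quotient.mk (Q.toQuiver.relIdeal α) P ∈ Q.toQuiver.invariants α),
    V.presheaf.map (homOfLE (le_top : U ≤ ⊤)).op (τ ⟨_, hP⟩) =
      MvPolynomial.eval₂ (constants k V U) (fun x => M x.i x.j x.a x.p x.q) P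

end BondalQuiver

end BondalQuiver

end Bondal

end

/-! Surjectivity comes from traces of cycles. Given a function `f` and a node `i` whose rank is
invertible in `k`, multiplication by `f` is an element of `End(Eᵢ)`. If the arrows generate `A`, it
is a linear combination of cycles at `i`. The trace of the same combination of generic matrices is
an invariant function, and its pullback is the trace of `f • 1`, namely `αᵢ f`. Dividing by `αᵢ`
gives a preimage of `f`.

Generation (`BondalQuiver.pathSpan_eq_top`) holds because decency makes the degree `j - i + n r`
non-negative, and zero only on constant multiples of identities. Everything of positive degree is
reached from the arrows by induction on the degree, as for any positively graded algebra. Isolating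
homogeneous components requires the weight spaces to be independent (`iSupIndep_weightSpace`).

The pullback exists because the values of an invariant function in local frames glue. Two frames
differ by a matrix with entries in `Γ(V, U)`, whereas invariance is assumed only under matrices over
`k`. The gap is closed by density of the `k`-points of `∏ GL(αᵢ)`, `k` being infinite
(`QuiverWithRelations.eval_changeBasis`). -/

noncomputable section

namespace Bondal

/-! ### Scalars, composition and pullback. -/

section Scalars

variable {X Y : Scheme.{u}}

lemma scalarEnd_comp {M N : X.Modules} (c : Γ(X, ⊤)) (f : M ⟶ N) :
    scalarEnd M c ≫ f = f ≫ scalarEnd N c := by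
  apply Scheme.Modules.hom_ext
  intro U
  ext x
  rw [Scheme.Modules.Hom.comp_app, Scheme.Modules.Hom.comp_app, AddCommGrpCat.comp_apply,
    AddCommGrpCat.comp_apply, scalarEnd_app, scalarEnd_app, Scheme.Modules.Hom.app_smul]

lemma scalarEnd_mul (M : X.Modules) (a b : Γ(X, ⊤)) :
    scalarEnd M (a * b) = scalarEnd M a ≫ scalarEnd M b := by
  rw [mul_comm]
  exact map_mul (scalarHom M) b a

/-- Sections of a pullback are not explicit, so the comparison is made after passing to the adjoint
maps into the pushforward, where scalars act through `f.app`. -/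
lemma pullback_map_scalarEnd (f : X ⟶ Y) (M : Y.Modules) (c : Γ(Y, ⊤)) :
    (Scheme.Modules.pullback f).map (scalarEnd M c) = scalarEnd _ (f.appTop c) := by
  apply ((Scheme.Modules.pullbackPushforwardAdjunction f).homEquiv _ _).injective
  rw [Adjunction.homEquiv_unit, Adjunction.homEquiv_unit]
  refine ((Scheme.Modules.pullbackPushforwardAdjunction f).unit.naturality
    (scalarEnd M c)).symm.trans ((scalarEnd_comp c _).trans ?_)
  congr 1
  apply Scheme.Modules.hom_ext
  intro U
  ext x
  rw [Scheme.Modules.pushforward_map_app]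
  erw [scalarEnd_app, scalarEnd_app]
  change (f.app U _ : Γ(X, f ⁻¹ᵁ U)) • (show Γ((Scheme.Modules.pullback f).obj M, f ⁻¹ᵁ U) from x) = _
  congr 1
  exact congr($(f.naturality (homOfLE (le_top : U ≤ ⊤)).op) c)

variable {k : Type u} [Field k] [X.Over (Spec (.of k))]

lemma smul_def {M N : X.Modules} (a : k) (f : M ⟶ N) :
    a • f = f ≫ scalarEnd N (constants k X ⊤ a) := rfl

lemma smul_comp {L M N : X.Modules} (a : k) (f : L ⟶ M) (g : M ⟶ N) :
    (a • f) ≫ g = a • (f ≫ g) := by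
  rw [smul_def, smul_def, Category.assoc, scalarEnd_comp, Category.assoc]

lemma comp_smul {L M N : X.Modules} (a : k) (f : L ⟶ M) (g : M ⟶ N) :
    f ≫ (a • g) = a • (f ≫ g) := by
  rw [smul_def, smul_def, Category.assoc]

lemma map_constants (U W : X.Opens) (h : U ≤ W) (a : k) :
    X.presheaf.map (homOfLE h).op (constants k X W a) = constants k X U a := by
  simp only [constants, CommRingCat.hom_comp, RingHom.comp_apply]
  rw [← CommRingCat.comp_apply, ← Functor.map_comp]
  rfl

lemma appTop_constants [Y.Over (Spec (.of k))] (f : X ⟶ Y)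
    (hf : f ≫ (Y ↘ Spec (.of k)) = X ↘ Spec (.of k)) (a : k) :
    f.appTop (constants k Y ⊤ a) = constants k X ⊤ a := by
  have e (Z : Scheme.{u}) [Z.Over (Spec (.of k))] : constants k Z ⊤ a =
      (Z ↘ Spec (.of k)).appTop ((Scheme.ΓSpecIso (.of k)).inv a) := by
    simp only [constants, CommRingCat.hom_comp, RingHom.comp_apply]
    exact congr($(Z.presheaf.map_id _) _)
  rw [e, e, ← hf, Scheme.Hom.comp_appTop]
  rfl

end Scalars

/-! ### Weight spaces in `Hom(M, N)` and translation by constants. -/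

section Weights

variable {k : Type u} [Field k] {V : Scheme.{u}} [V.Over (Spec (.of k))] {σ : GmAction k V}
  {L M N : V.Modules} (χ : EquivariantStructure σ L) (φ : EquivariantStructure σ M)
  (ψ : EquivariantStructure σ N)

lemma HasWeight.add {r : ℤ} {f g : M ⟶ N} (hf : HasWeight φ ψ r f) (hg : HasWeight φ ψ r g) :
    HasWeight φ ψ r (f + g) := by
  intro T t x
  simp only [Functor.map_add, Preadditive.add_comp, Preadditive.comp_add, hf t x, hg t x]

lemma HasWeight.smul {r : ℤ} (a : k) {f : M ⟶ N} (hf : HasWeight φ ψ r f) :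
    HasWeight φ ψ r (a • f) := by
  intro T t x
  -- With `T` made a `k`-scheme through `x`, the point `t·x` is also a `k`-morphism by `act_over`,
  -- so both pullbacks fix constants.
  let : T.Over (Spec (.of k)) := ⟨x ≫ (V ↘ Spec (.of k))⟩
  have h1 : (σ.act t x).appTop (constants k V ⊤ a) = constants k T ⊤ a :=
    appTop_constants _ (σ.act_over t x) a
  have h2 : x.appTop (constants k V ⊤ a) = constants k T ⊤ a := appTop_constants _ rfl a
  rw [smul_def, Functor.map_comp, Functor.map_comp, pullback_map_scalarEnd,
    pullback_map_scalarEnd, h1, h2, Category.assoc, scalarEnd_comp, ← Category.assoc, hf t x]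
  simp only [Category.assoc]
  rw [scalarEnd_comp]

/-- The morphisms of weight `r`. -/
def weightSpace (r : ℤ) : Submodule k (M ⟶ N) where
  carrier := {f | HasWeight φ ψ r f}
  add_mem' := HasWeight.add φ ψ
  zero_mem' T t x := by simp
  smul_mem' a _ := HasWeight.smul φ ψ a

variable {χ φ ψ} in
lemma HasWeight.comp {r s : ℤ} {f : L ⟶ M} {g : M ⟶ N} (hf : HasWeight χ φ r f)
    (hg : HasWeight φ ψ s g) : HasWeight χ ψ (r + s) (f ≫ g) := by
  intro T t x
  rw [Functor.map_comp, Category.assoc, hg t x, ← Category.assoc, hf t x, zpow_add, Units.val_mul,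
    scalarEnd_mul]
  simp only [Functor.map_comp, Category.assoc]
  rw [reassoc_of% scalarEnd_comp ((t ^ r : Γ(T, ⊤)ˣ) : Γ(T, ⊤))
    ((Scheme.Modules.pullback x).map g)]

variable (k) in
/-- A nonzero constant as a point of `𝔾ₘ`. -/
def constUnit (V : Scheme.{u}) [V.Over (Spec (.of k))] (t : kˣ) : Γ(V, ⊤)ˣ :=
  Units.map (constants k V ⊤).toMonoidHom t

/-- Translation of morphisms by a constant point of `𝔾ₘ`. -/
def translate (t : kˣ) : (M ⟶ N) →ₗ[k] (M ⟶ N) where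
  toFun f := (Scheme.Modules.pullbackId V).inv.app M ≫ (φ.iso (constUnit k V t) (𝟙 V)).inv ≫
    (Scheme.Modules.pullback _).map f ≫ (ψ.iso (constUnit k V t) (𝟙 V)).hom ≫
      (Scheme.Modules.pullbackId V).hom.app N
  map_add' f g := by
    simp only [Functor.map_add, Preadditive.add_comp, Preadditive.comp_add]
  map_smul' a f := by
    rw [smul_def, smul_def, Functor.map_comp, pullback_map_scalarEnd,
      appTop_constants (X := V) _ (by rw [σ.act_over, Category.id_comp])]
    simp only [Category.assoc]
    congr 3
    rw [reassoc_of% scalarEnd_comp, scalarEnd_comp]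
    rfl

variable {φ ψ} in
lemma HasWeight.translate_eq {r : ℤ} {f : M ⟶ N} (hf : HasWeight φ ψ r f) (t : kˣ) :
    translate φ ψ t f = ((t ^ r : kˣ) : k) • f := by
  have e : (((constUnit k V t) ^ r : Γ(V, ⊤)ˣ) : Γ(V, ⊤)) =
      constants k V ⊤ ((t ^ r : kˣ) : k) := by
    rw [constUnit, ← map_zpow]
    rfl
  have h := hf (constUnit k V t) (𝟙 V)
  rw [e] at h
  simp only [translate, LinearMap.coe_mk, AddHom.coe_mk]
  rw [reassoc_of% h, Iso.inv_hom_id_assoc, scalarEnd_comp]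
  have n := (Scheme.Modules.pullbackId V).hom.naturality f
  rw [reassoc_of% n]
  simp [smul_def]

end Weights

/-! ### Independence of eigenspaces and homogeneous components. -/

section LinearAlgebra

variable {k M : Type*} [Field k] [AddCommGroup M] [Module k M]

/-- Each coincidence `t ^ a = t ^ b` with `a ≠ b` confines `t` to a finite group of roots of unity,
and `kˣ` is infinite. -/
lemma exists_unit_zpow_injOn [Infinite k] (s : Finset ℤ) :
    ∃ t : kˣ, Set.InjOn (fun r : ℤ => t ^ r) s := by
  have hfin : (⋃ p ∈ (s ×ˢ s).filter (fun p => p.1 ≠ p.2),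
      {t : kˣ | t ^ p.1 = t ^ p.2}).Finite := by
    refine Set.Finite.biUnion (Finset.finite_toSet _) fun p hp => ?_
    have hne : p.1 - p.2 ≠ 0 := sub_ne_zero.mpr (Finset.mem_filter.mp hp).2
    have : NeZero (p.1 - p.2).natAbs := ⟨Int.natAbs_ne_zero.mpr hne⟩
    have hroots : Finite (rootsOfUnity (p.1 - p.2).natAbs k) := inferInstance
    refine Set.Finite.subset (s := (rootsOfUnity (p.1 - p.2).natAbs k : Set kˣ)) hroots
      fun t ht => ?_
    have h1 : t ^ (p.1 - p.2) = 1 := by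
      rw [zpow_sub, (ht : t ^ p.1 = t ^ p.2), mul_inv_cancel]
    rw [SetLike.mem_coe, mem_rootsOfUnity, pow_natAbs_eq_one]
    exact h1
  have : Infinite {a : k // a ≠ 0} := (Set.finite_singleton (0 : k)).infinite_compl.to_subtype
  have : Infinite kˣ := unitsEquivNeZero.infinite_iff.mpr this
  obtain ⟨t, ht⟩ := hfin.exists_notMem
  refine ⟨t, fun a ha b hb hab => ?_⟩
  by_contra hne
  exact ht (Set.mem_biUnion (x := (a, b))
    (Finset.mem_coe.mpr (Finset.mem_filter.mpr ⟨Finset.mk_mem_product ha hb, hne⟩)) hab)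

/-- Independence concerns finitely many weights at a time, so a single `t` separating them suffices:
the spaces then lie in distinct eigenspaces of `T t`. -/
lemma iSupIndep_of_zpow_eigen [Infinite k] (W : ℤ → Submodule k M) (T : kˣ → M →ₗ[k] M)
    (h : ∀ r t, ∀ f ∈ W r, T t f = ((t ^ r : kˣ) : k) • f) : iSupIndep W := by
  rw [iSupIndep_iff_finsetSum_eq_zero_imp_eq_zero]
  intro s v hv hsum
  obtain ⟨t, ht⟩ := exists_unit_zpow_injOn (k := k) s
  have hinj : Function.Injective fun r : s => ((t ^ (r : ℤ) : kˣ) : k) := fun a b hab =>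
    Subtype.ext (ht a.2 b.2 (Units.ext hab))
  have key := ((Module.End.eigenspaces_iSupIndep (T t)).comp hinj).mono
    (t := fun r : s => W r) fun r f hf => by
      rw [Function.comp_apply, Module.End.mem_eigenspace_iff]
      exact h r t f hf
  rw [iSupIndep_iff_finsetSum_eq_zero_imp_eq_zero] at key
  intro i hi
  have := key Finset.univ (fun r => v r) (fun r _ => hv r r.2)
    (by rwa [Finset.sum_coe_sort s v]) ⟨i, hi⟩ (Finset.mem_univ _)
  exact this

/-- The generators outside `W r` contribute a vector in the span of the other `W j`; it also lies in
`W r`, hence vanishes. -/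
lemma mem_span_inter_of_iSupIndep {ι : Type*} {W : ι → Submodule k M} (hW : iSupIndep W)
    {S : Set M} (hS : ∀ f ∈ S, ∃ r, f ∈ W r) {r : ι} {f : M} (hf : f ∈ Submodule.span k S)
    (hr : f ∈ W r) : f ∈ Submodule.span k (S ∩ W r) := by
  have hle : Submodule.span k S ≤ Submodule.span k (S ∩ W r) ⊔ ⨆ j, ⨆ (_ : j ≠ r), W j := by
    rw [Submodule.span_le]
    intro g hg
    obtain ⟨j, hj⟩ := hS g hg
    by_cases hjr : j = r
    · subst hjr
      exact Submodule.mem_sup_left (Submodule.subset_span ⟨hg, hj⟩)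
    · exact Submodule.mem_sup_right (Submodule.mem_iSup_of_mem j
        (Submodule.mem_iSup_of_mem hjr hj))
  obtain ⟨a, ha, b, hb, rfl⟩ := Submodule.mem_sup.mp (hle hf)
  have haW : a ∈ W r := Submodule.span_le.mpr Set.inter_subset_right ha
  have hb0 : b = 0 := Submodule.disjoint_def.mp (hW r) b (by simpa using sub_mem hr haW) hb
  simpa [hb0] using ha

end LinearAlgebra

/-! ### Endomorphisms of weight zero. -/

section Weights

variable {k : Type u} [Field k] {V : Scheme.{u}} [V.Over (Spec (.of k))] {σ : GmAction k V}
  {M N : V.Modules} (φ : EquivariantStructure σ M) (ψ : EquivariantStructure σ N)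

lemma iSupIndep_weightSpace [Infinite k] : iSupIndep (weightSpace φ ψ) :=
  iSupIndep_of_zpow_eigen _ (translate φ ψ) fun _ t _ hf => hf.translate_eq t

lemma FunctionHasWeight.hasWeight_scalarEnd {r : ℤ} {c : Γ(V, ⊤)} (hc : FunctionHasWeight σ r c) :
    HasWeight φ φ r (scalarEnd M c) := by
  intro T t x
  rw [pullback_map_scalarEnd, pullback_map_scalarEnd, hc t x, scalarEnd_comp, mul_comm,
    scalarEnd_mul]

lemma exists_eq_smul_id_of_hasWeight_zero [Infinite k]
    (hnonneg : AddSubgroup.closure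
      {f : Γ(V, ⊤) | ∃ r : ℤ, 0 ≤ r ∧ FunctionHasWeight σ r f} = ⊤)
    (hzero : ∀ f : Γ(V, ⊤), FunctionHasWeight σ 0 f → f ∈ Set.range (constants k V ⊤))
    (hM : Function.Surjective (scalarHom M)) {g : M ⟶ M} (hg : HasWeight φ φ 0 g) :
    ∃ a : k, g = a • 𝟙 M := by
  set S : Set (M ⟶ M) := {g | ∃ r c, FunctionHasWeight σ r c ∧ g = scalarEnd M c}
  have hS : ∀ c : Γ(V, ⊤), scalarHom M c ∈ Submodule.span k S := by
    intro c
    have hc : c ∈ AddSubgroup.closure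
      {f : Γ(V, ⊤) | ∃ r : ℤ, 0 ≤ r ∧ FunctionHasWeight σ r f} := hnonneg ▸ AddSubgroup.mem_top c
    induction hc using AddSubgroup.closure_induction with
    | mem c hc => exact Submodule.subset_span ⟨hc.choose, c, hc.choose_spec.2, rfl⟩
    | zero => exact (map_zero (scalarHom M)) ▸ Submodule.zero_mem _
    | add a b _ _ ha hb => exact (map_add (scalarHom M) a b) ▸ Submodule.add_mem _ ha hb
    | neg a _ ha => exact (map_neg (scalarHom M) a) ▸ Submodule.neg_mem _ ha
  obtain ⟨c, rfl⟩ := hM g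
  have key := mem_span_inter_of_iSupIndep (iSupIndep_weightSpace φ φ)
    (by rintro _ ⟨r, c, hc, rfl⟩; exact ⟨r, hc.hasWeight_scalarEnd φ⟩) (hS c) hg
  suffices h : Submodule.span k (S ∩ weightSpace φ φ 0) ≤ Submodule.span k {𝟙 M} by
    obtain ⟨a, ha⟩ := Submodule.mem_span_singleton.mp (h key)
    exact ⟨a, ha.symm⟩
  rw [Submodule.span_le]
  rintro _ ⟨⟨r, c, hc, rfl⟩, h0⟩
  -- A generator of weight zero comes either from a function of weight zero, hence constant, or from
  -- a function of weight `r ≠ 0`, in which case it lies in two independent weight spaces and is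
  -- zero.
  by_cases hr : r = 0
  · subst hr
    obtain ⟨a, rfl⟩ := hzero c hc
    refine Submodule.mem_span_singleton.mpr ⟨a, ?_⟩
    rw [smul_def, Category.id_comp]
  · have := Submodule.disjoint_def.mp ((iSupIndep_weightSpace φ φ).pairwiseDisjoint hr) _
      (hc.hasWeight_scalarEnd φ) h0
    rw [this]
    exact Submodule.zero_mem _

end Weights

/-! ### The arrows generate `A`. -/

section Generation

variable {k : Type u} [Field k] {V : Scheme.{u}} [V.Over (Spec (.of k))]
  {n : ℕ} {σ : GmAction k V} {E : Fin n → V.Modules} {φ : ∀ i, EquivariantStructure σ (E i)}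

lemma HasDegree.comp {i j l : Fin n} {d e : ℤ} {f : E i ⟶ E j} {g : E j ⟶ E l}
    (hf : HasDegree φ d f) (hg : HasDegree φ e g) : HasDegree φ (d + e) (f ≫ g) := by
  obtain ⟨r, rfl, hr⟩ := hf
  obtain ⟨s, rfl, hs⟩ := hg
  exact ⟨r + s, by ring, hr.comp hs⟩

lemma HasDegree.eq_of_hasWeight {i j : Fin n} {d r : ℤ} {f : E i ⟶ E j} [Infinite k]
    (hf : HasDegree φ d f) (hr : HasWeight (φ i) (φ j) r f) (h0 : f ≠ 0) :
    d = (j : ℤ) - (i : ℤ) + n * r := by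
  obtain ⟨s, rfl, hs⟩ := hf
  by_contra hne
  have hsr : s ≠ r := by rintro rfl; exact hne rfl
  exact h0 (Submodule.disjoint_def.mp
    ((iSupIndep_weightSpace (φ i) (φ j)).pairwiseDisjoint hsr) _ hs hr)

namespace BondalQuiver

variable (Q : BondalQuiver φ)

/-- The span of the paths from `i` to `j` in `Hom(Eⱼ, Eᵢ)`. -/
def pathSpan (i j : Fin n) : Submodule k (E j ⟶ E i) :=
  Submodule.span k (Set.range (pathHom Q.hom (i := i) (j := j)))

lemma exists_pathHom_comp {i j l : Fin n} (p : QPath Q.Arr i j) (q : QPath Q.Arr j l) :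
    ∃ r : QPath Q.Arr i l, pathHom Q.hom r = pathHom Q.hom q ≫ pathHom Q.hom p := by
  induction q with
  | nil => exact ⟨p, (Category.id_comp _).symm⟩
  | cons q a ih =>
    obtain ⟨r, hr⟩ := ih
    exact ⟨.cons r a, by simp only [pathHom, hr, Category.assoc]⟩

lemma comp_mem_pathSpan {i j l : Fin n} {f : E l ⟶ E j} {g : E j ⟶ E i}
    (hf : f ∈ Q.pathSpan j l) (hg : g ∈ Q.pathSpan i j) : f ≫ g ∈ Q.pathSpan i l := by
  induction hf using Submodule.span_induction with
  | mem f hf =>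
    obtain ⟨q, rfl⟩ := hf
    induction hg using Submodule.span_induction with
    | mem g hg =>
      obtain ⟨p, rfl⟩ := hg
      exact Submodule.subset_span (Q.exists_pathHom_comp p q)
    | zero => simp
    | add a b _ _ ha hb => rw [Preadditive.comp_add]; exact add_mem ha hb
    | smul c a _ ha => rw [comp_smul]; exact Submodule.smul_mem _ c ha
  | zero => simp
  | add a b _ _ ha hb => rw [Preadditive.add_comp]; exact add_mem ha hb
  | smul c a _ ha => rw [smul_comp]; exact Submodule.smul_mem _ c ha

/-- Bilinearity of composition allows the two factors to be taken homogeneous, so that their degrees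
are available for induction. -/
lemma posPartSq_le_span (i j : Fin n) : posPartSq φ i j ≤ Submodule.span k
    {f | ∃ (l : Fin n) (g : E i ⟶ E l) (h : E l ⟶ E j) (d e : ℤ), 0 < d ∧ 0 < e ∧
      HasDegree φ d g ∧ HasDegree φ e h ∧ f = g ≫ h} := by
  rw [posPartSq, Submodule.span_le]
  rintro _ ⟨l, g, h, hg, hh, rfl⟩
  rw [posPart] at hg hh
  rw [SetLike.mem_coe]
  induction hg using Submodule.span_induction with
  | mem g hg =>
    obtain ⟨d, hd, hg⟩ := hg
    induction hh using Submodule.span_induction with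
    | mem h hh =>
      obtain ⟨e, he, hh⟩ := hh
      exact Submodule.subset_span ⟨l, g, h, d, e, hd, he, hg, hh, rfl⟩
    | zero => simp
    | add a b _ _ ha hb => rw [Preadditive.comp_add]; exact add_mem ha hb
    | smul c a _ ha => rw [comp_smul]; exact Submodule.smul_mem _ c ha
  | zero => simp
  | add a b _ _ ha hb => rw [Preadditive.add_comp]; exact add_mem ha hb
  | smul c a _ ha => rw [smul_comp]; exact Submodule.smul_mem _ c ha

/-- Induction on the degree: modulo arrows, an element of `A₊` is a sum of products of two elements
of positive degree, each of degree smaller than that of the product. -/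
lemma mem_pathSpan_of_hasDegree [Infinite k] (m : ℕ) : ∀ (i j : Fin n) (d : ℤ), 0 < d → d < m →
    ∀ f : E j ⟶ E i, HasDegree φ d f → f ∈ Q.pathSpan i j := by
  induction m with
  | zero => intro i j d h0 h1; omega
  | succ m ih =>
    intro i j d h0 h1 f hf
    set S : Set (E j ⟶ E i) := Set.range (Q.hom i j) ∪
      {f | ∃ (l : Fin n) (g : E j ⟶ E l) (h : E l ⟶ E i) (d e : ℤ), 0 < d ∧ 0 < e ∧
        HasDegree φ d g ∧ HasDegree φ e h ∧ f = g ≫ h} with hSdef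
    have hfS : f ∈ Submodule.span k S := by
      have hpos : f ∈ posPart φ j i := Submodule.subset_span ⟨d, h0, hf⟩
      rw [← Q.span i j] at hpos
      rw [hSdef, Submodule.span_union]
      exact sup_le_sup le_rfl (posPartSq_le_span (φ := φ) j i) hpos
    have hS : ∀ f ∈ S, ∃ d, 0 < d ∧ HasDegree φ d f := by
      rintro _ (⟨a, rfl⟩ | ⟨l, g, h, d, e, hd, he, hg, hh, rfl⟩)
      · exact Q.homogeneous i j a
      · exact ⟨d + e, add_pos hd he, hg.comp hh⟩
    obtain ⟨r, hdr, hr⟩ := hf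
    -- Only generators of the weight of `f` are kept, so a nonzero product among them has degree
    -- exactly `d`. A zero product gives no control on the degrees of its factors and is treated
    -- apart.
    have key := mem_span_inter_of_iSupIndep (iSupIndep_weightSpace (φ j) (φ i))
      (fun f hf => by obtain ⟨_, _, r, _, hr⟩ := hS f hf; exact ⟨r, hr⟩) hfS hr
    refine Submodule.span_le.mpr ?_ key
    rintro _ ⟨⟨a, rfl⟩ | ⟨l, g, h, d', e', hd, he, hg, hh, rfl⟩, hw⟩
    · refine Submodule.subset_span ⟨.cons .nil a, ?_⟩
      simp [pathHom]
    · by_cases hz : g ≫ h = 0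
      · rw [hz]
        exact Submodule.zero_mem _
      · have := (hg.comp hh).eq_of_hasWeight hw hz
        exact Q.comp_mem_pathSpan (ih _ _ d' hd (by push_cast at h1; omega) g hg)
          (ih _ _ e' he (by push_cast at h1; omega) h hh)

/-- The arrows generate `A = End(⊕ Eᵢ)ᵒᵖ`. -/
theorem pathSpan_eq_top [Infinite k] (hV : NearlyProjective σ) (hdecent : Decent φ)
    (i j : Fin n) : Q.pathSpan i j = ⊤ := by
  have hpos : ∀ (r : ℤ) (f : E j ⟶ E i), HasWeight (φ j) (φ i) r f →
      0 < (i : ℤ) - (j : ℤ) + n * r → f ∈ Q.pathSpan i j := fun r f hf hd =>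
    Q.mem_pathSpan_of_hasDegree (((i : ℤ) - (j : ℤ) + n * r).toNat + 1) i j _ hd
      (by push_cast; omega) f ⟨r, rfl, hf⟩
  rw [eq_top_iff]
  have hi := i.2
  have hj := j.2
  -- The degree is positive when `i < j`, since `r ≥ 1` and `j - i < n`. When `j ≤ i` it vanishes
  -- only for `r = 0` and `i = j`, where constants come from the trivial path.
  rcases lt_or_ge i j with hij | hij
  · rw [← hdecent.pos j i hij, Submodule.span_le]
    rintro f ⟨r, hr, hf⟩
    refine hpos r f hf ?_
    nlinarith
  · rw [← hdecent.nonneg j i, Submodule.span_le]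
    rintro f ⟨r, hr, hf⟩
    rcases hr.eq_or_lt with rfl | hr
    · rcases hij.eq_or_lt with rfl | hij
      · obtain ⟨a, rfl⟩ := exists_eq_smul_id_of_hasWeight_zero (φ j) hV.nonneg
          (fun f => (hV.weight_zero f).mp) (hdecent.endo j).2 hf
        exact Submodule.smul_mem _ a (Submodule.subset_span ⟨.nil, rfl⟩)
      · refine hpos 0 f hf ?_
        have : (j : ℤ) < i := by exact_mod_cast hij
        omega
    · refine hpos r f hf ?_
      nlinarith

end BondalQuiver

end Generation

/-! ### Polynomials over a `k`-algebra vanishing at all `k`-points. -/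

section PolynomialVanishing

/-- `B` need not be a domain. Linear functionals `B → k` separate elements, and applying one to the
coefficients reduces the claim to polynomials over the infinite field `k`. -/
lemma eq_zero_of_forall_aeval_eq_zero {k B ι : Type*} [Field k] [Infinite k] [CommRing B]
    [Algebra k B] (F : MvPolynomial ι B)
    (h : ∀ x : ι → k, MvPolynomial.eval (fun i => algebraMap k B (x i)) F = 0) : F = 0 := by
  ext m
  rw [MvPolynomial.coeff_zero, ← Module.forall_dual_apply_eq_zero_iff k]
  intro l
  let Fl : MvPolynomial ι k := ∑ m ∈ F.support, MvPolynomial.monomial m (l (F.coeff m))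
  have hFl : ∀ m, Fl.coeff m = l (F.coeff m) := fun m => by
    classical
    simp only [Fl, MvPolynomial.coeff_sum, MvPolynomial.coeff_monomial, Finset.sum_ite_eq']
    split_ifs with hm
    · rfl
    · rw [MvPolynomial.notMem_support_iff.mp hm, map_zero]
  suffices hz : Fl = 0 by rw [← hFl, hz, MvPolynomial.coeff_zero]
  refine MvPolynomial.funext fun x => ?_
  have hsupp : Fl.support ⊆ F.support := fun m hm => by
    rw [MvPolynomial.mem_support_iff, hFl] at hm
    rw [MvPolynomial.mem_support_iff]
    exact fun h0 => hm (by rw [h0, map_zero])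
  have key := congrArg l (h x)
  rw [map_zero, MvPolynomial.eval_eq, map_sum] at key
  rw [map_zero, MvPolynomial.eval_eq, ← key,
    Finset.sum_subset hsupp (fun m _ hm => by
      rw [MvPolynomial.notMem_support_iff.mp hm, zero_mul])]
  refine Finset.sum_congr rfl fun m _ => ?_
  rw [hFl]
  simp_rw [← map_pow, ← map_prod]
  rw [mul_comm (MvPolynomial.coeff m F), ← Algebra.smul_def, map_smul, smul_eq_mul, mul_comm]

end PolynomialVanishing

/-! ### Invariance under matrices over arbitrary rings, and invariant traces. -/

namespace QuiverWithRelations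

variable {k : Type u} [Field k] {n : ℕ} (Q : QuiverWithRelations k n) {α : Fin n → ℕ}

/-- The point of affine space given by a family of matrices. -/
def point {R : Type*} (M : ∀ i j, Q.Arr i j → Matrix (Fin (α j)) (Fin (α i)) R) :
    Q.Coord α → R :=
  fun x => M x.i x.j x.a x.p x.q

/-- Change of bases of a family of matrices. -/
def changeBasis {R : Type*} [CommRing R] (g : ∀ i, GL (Fin (α i)) R)
    (M : ∀ i j, Q.Arr i j → Matrix (Fin (α j)) (Fin (α i)) R) :
    ∀ i j, Q.Arr i j → Matrix (Fin (α j)) (Fin (α i)) R :=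
  fun i j a => ((g j)⁻¹ : GL (Fin (α j)) R).val * M i j a * (g i).val

lemma map_point_changeBasis {R S : Type*} [CommRing R] [CommRing S] (f : R →+* S)
    (g : ∀ i, GL (Fin (α i)) R) (M : ∀ i j, Q.Arr i j → Matrix (Fin (α j)) (Fin (α i)) R)
    (x : Q.Coord α) :
    f (Q.point (Q.changeBasis g M) x) =
      Q.point (Q.changeBasis (fun i => (g i).map f) fun i j a => (M i j a).map f) x := by
  have h : ∀ i, ((((g i).map f)⁻¹ : GL (Fin (α i)) S)).val =
      ((g i)⁻¹ : GL (Fin (α i)) R).val.map f := fun i => by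
    rw [← map_inv]
    rfl
  have h' : ∀ i, ((g i).map f).val = (g i).val.map f := fun i => rfl
  simp only [point, changeBasis, h, h', ← Matrix.map_mul]
  rfl

section Generic

variable (α) {B : Type*} [CommRing B]

/-- The generic square matrices. -/
def genericMatrix (B : Type*) [CommRing B] (i : Fin n) :
    Matrix (Fin (α i)) (Fin (α i)) (MvPolynomial (Σ i, Fin (α i) × Fin (α i)) B) :=
  Matrix.of fun p q => MvPolynomial.X ⟨i, p, q⟩

/-- The product of the generic determinants. -/
def genericDet (B : Type*) [CommRing B] : MvPolynomial (Σ i, Fin (α i) × Fin (α i)) B :=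
  ∏ i, (genericMatrix α B i).det

lemma isUnit_det_map_genericMatrix (B : Type*) [CommRing B] (i : Fin n) :
    IsUnit ((genericMatrix α B i).map
      (algebraMap _ (Localization.Away (genericDet α B)))).det := by
  rw [← RingHom.mapMatrix_apply, ← RingHom.map_det]
  have h : (genericMatrix α B i).det ∣ genericDet α B :=
    Finset.dvd_prod_of_mem (fun i => (genericMatrix α B i).det) (Finset.mem_univ i)
  exact isUnit_of_dvd_unit (map_dvd _ h) (IsLocalization.Away.algebraMap_isUnit (genericDet α B))

/-- The generic invertible matrices. -/
def genericGL (B : Type*) [CommRing B] (i : Fin n) :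
    GL (Fin (α i)) (Localization.Away (genericDet α B)) :=
  Matrix.GeneralLinearGroup.mk'' _ (isUnit_det_map_genericMatrix α B i)

lemma genericGL_val (B : Type*) [CommRing B] (i : Fin n) :
    (genericGL α B i).val = (genericMatrix α B i).map
      (algebraMap _ (Localization.Away (genericDet α B))) := rfl

variable {α}

lemma eval_genericDet {R : Type*} [CommRing R] (b : B →+* R)
    (g : ∀ i, Matrix (Fin (α i)) (Fin (α i)) R) :
    MvPolynomial.eval₂Hom b (fun x => g x.1 x.2.1 x.2.2) (genericDet α B) =
      ∏ i, (g i).det := by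
  rw [genericDet, map_prod]
  refine Finset.prod_congr rfl fun i _ => ?_
  rw [RingHom.map_det]
  congr 1
  ext p q
  simp [genericMatrix]

/-- The specialization of the generic invertible matrices to given ones. -/
def specialize {R : Type*} [CommRing R] (b : B →+* R) (g : ∀ i, GL (Fin (α i)) R) :
    Localization.Away (genericDet α B) →+* R :=
  IsLocalization.Away.lift (genericDet α B)
    (g := MvPolynomial.eval₂Hom b (fun x => (g x.1).val x.2.1 x.2.2)) (by
      rw [eval_genericDet b fun i => (g i).val]
      exact IsUnit.prod_univ_iff.mpr fun i => (Matrix.isUnit_iff_isUnit_det _).mp (g i).isUnit)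

lemma specialize_algebraMap {R : Type*} [CommRing R] (b : B →+* R) (g : ∀ i, GL (Fin (α i)) R)
    (F : MvPolynomial (Σ i, Fin (α i) × Fin (α i)) B) :
    specialize b g (algebraMap _ _ F) =
      MvPolynomial.eval₂Hom b (fun x => (g x.1).val x.2.1 x.2.2) F :=
  IsLocalization.Away.lift_eq _ _ _

lemma map_genericGL {R : Type*} [CommRing R] (b : B →+* R) (g : ∀ i, GL (Fin (α i)) R)
    (i : Fin n) : (genericGL α B i).map (specialize b g) = g i := by
  apply Units.ext
  ext p q
  rw [Matrix.GeneralLinearGroup.map_apply, genericGL_val, Matrix.map_apply,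
    specialize_algebraMap]
  simp [genericMatrix]

end Generic

/-- A polynomial function that is invariant under the `k`-points of `∏ GL(αᵢ)` along a family of
representations over `B` is invariant under the points with values in every `B`-algebra. -/
theorem eval_changeBasis_of_forall_field [Infinite k] {B R : Type u} [CommRing B] [Algebra k B]
    [CommRing R]
    (X : ∀ i j, Q.Arr i j → Matrix (Fin (α j)) (Fin (α i)) B) (P : MvPolynomial (Q.Coord α) k)
    (h : ∀ g : ∀ i, GL (Fin (α i)) k,
      MvPolynomial.eval₂ (algebraMap k B)
        (Q.point (Q.changeBasis (fun i => (g i).map (algebraMap k B)) X)) P =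
      MvPolynomial.eval₂ (algebraMap k B) (Q.point X) P)
    (b : B →+* R) (g : ∀ i, GL (Fin (α i)) R) :
    MvPolynomial.eval₂ (b.comp (algebraMap k B))
        (Q.point (Q.changeBasis g fun i j a => (X i j a).map b)) P =
      MvPolynomial.eval₂ (b.comp (algebraMap k B)) (Q.point fun i j a => (X i j a).map b) P := by
  let c : B →+* Localization.Away (genericDet α B) :=
    (algebraMap (MvPolynomial (Σ i, Fin (α i) × Fin (α i)) B) _).comp MvPolynomial.C
  -- `D` is the failure of invariance at the generic invertible matrices. Every other failure is a
  -- specialization of it, so it is enough that `D = 0`.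
  let D : Localization.Away (genericDet α B) :=
    MvPolynomial.eval₂ (c.comp (algebraMap k B))
        (Q.point (Q.changeBasis (genericGL α B) fun i j a => (X i j a).map c)) P -
      MvPolynomial.eval₂ (c.comp (algebraMap k B)) (Q.point fun i j a => (X i j a).map c) P
  have hc : ∀ {R : Type u} [CommRing R] (b : B →+* R) (g : ∀ i, GL (Fin (α i)) R),
      (specialize b g).comp c = b := fun b g => by
    ext x
    simp only [c, RingHom.comp_apply, specialize_algebraMap]
    simp
  have hD : ∀ {R : Type u} [CommRing R] (b : B →+* R) (g : ∀ i, GL (Fin (α i)) R),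
      specialize b g D = MvPolynomial.eval₂ (b.comp (algebraMap k B))
        (Q.point (Q.changeBasis g fun i j a => (X i j a).map b)) P -
      MvPolynomial.eval₂ (b.comp (algebraMap k B)) (Q.point fun i j a => (X i j a).map b) P := by
    intro R _ b g
    have hX : ∀ i j a, ((X i j a).map c).map (specialize b g) = (X i j a).map b := fun i j a => by
      rw [Matrix.map_map, ← RingHom.coe_comp, hc]
    have h1 : (fun x => specialize b g
        (Q.point (Q.changeBasis (genericGL α B) fun i j a => (X i j a).map c) x)) =
        Q.point (Q.changeBasis g fun i j a => (X i j a).map b) := by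
      funext x
      rw [map_point_changeBasis]
      simp only [map_genericGL, hX]
    have h2 : (fun x => specialize b g (Q.point (fun i j a => (X i j a).map c) x)) =
        Q.point fun i j a => (X i j a).map b := by
      funext x
      exact congr($(hX x.i x.j x.a) x.p x.q)
    simp only [D, map_sub, MvPolynomial.hom_eval₂, ← RingHom.comp_assoc, hc]
    rw [← h1, ← h2]
  suffices hD0 : D = 0 by
    rw [← sub_eq_zero, ← hD, hD0, map_zero]
  obtain ⟨⟨F, s⟩, hF⟩ := IsLocalization.surj (Submonoid.powers (genericDet α B)) D
  -- The numerator `F` is known to vanish only at invertible tuples over `k`; the factor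
  -- `genericDet` takes care of the singular ones.
  have hFd : F * genericDet α B = 0 := by
    refine eq_zero_of_forall_aeval_eq_zero (k := k) _ fun x => ?_
    let y : ∀ i, Matrix (Fin (α i)) (Fin (α i)) k := fun i => Matrix.of fun p q => x ⟨i, p, q⟩
    rw [map_mul]
    by_cases hy : ∏ i, (y i).det = 0
    · have hd := eval_genericDet (RingHom.id B) fun i => (y i).map (algebraMap k B)
      simp_rw [← RingHom.mapMatrix_apply, ← RingHom.map_det] at hd
      rw [← map_prod, hy, map_zero] at hd
      exact mul_eq_zero_of_right _ hd
    · let g₀ : ∀ i, GL (Fin (α i)) k := fun i => Matrix.GeneralLinearGroup.mkOfDetNeZero (y i)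
        fun h0 => hy (Finset.prod_eq_zero (Finset.mem_univ i) h0)
      have h0 : specialize (RingHom.id B) (fun i => (g₀ i).map (algebraMap k B)) D = 0 := by
        rw [hD, sub_eq_zero]
        exact h g₀
      have h1 := congrArg (specialize (RingHom.id B) fun i => (g₀ i).map (algebraMap k B)) hF
      rw [map_mul, h0, zero_mul, specialize_algebraMap] at h1
      exact mul_eq_zero_of_left h1.symm _
  have hu := (IsLocalization.map_units (Localization.Away (genericDet α B)) s).mul
    (IsLocalization.Away.algebraMap_isUnit (S := Localization.Away (genericDet α B))
      (genericDet α B))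
  rw [← hu.mul_left_eq_zero, ← mul_assoc, hF, ← map_mul, hFd, map_zero]

/-- The class of `P` is its value at the universal representation, which turns invariance in `B`
into a statement about evaluations. -/
lemma mk_eq_eval₂ (P : MvPolynomial (Q.Coord α) k) :
    Ideal.Quotient.mk (Q.relIdeal α) P = MvPolynomial.eval₂ (algebraMap k (Q.CoordRing α))
      (Q.point fun i j a => (Q.generic α i j a).map (Ideal.Quotient.mk (Q.relIdeal α))) P := by
  have h : Ideal.Quotient.mkₐ k (Q.relIdeal α) = MvPolynomial.aeval
      (Q.point fun i j a => (Q.generic α i j a).map (Ideal.Quotient.mk (Q.relIdeal α))) := by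
    ext x
    simp [point, generic]
  exact congr($h P)

lemma ringAct_mk (g : ∀ i, GL (Fin (α i)) k) (P : MvPolynomial (Q.Coord α) k) :
    Q.ringAct α g (Ideal.Quotient.mk (Q.relIdeal α) P) =
      MvPolynomial.eval₂ (algebraMap k (Q.CoordRing α))
        (Q.point (Q.changeBasis (fun i => (g i).map (algebraMap k (Q.CoordRing α)))
          fun i j a => (Q.generic α i j a).map (Ideal.Quotient.mk (Q.relIdeal α)))) P := by
  have h : (Q.ringAct α g).comp (Ideal.Quotient.mkₐ k (Q.relIdeal α)) = MvPolynomial.aeval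
      (Q.point (Q.changeBasis (fun i => (g i).map (algebraMap k (Q.CoordRing α)))
          fun i j a => (Q.generic α i j a).map (Ideal.Quotient.mk (Q.relIdeal α)))) := by
    ext x
    have hg : ∀ {i : Fin n} (g : GL (Fin (α i)) k),
        (Q.constMatrix g).map (Ideal.Quotient.mk (Q.relIdeal α)) =
          (g.map (algebraMap k (Q.CoordRing α))).val := fun g => rfl
    rw [MvPolynomial.aeval_X, point, changeBasis, ← map_inv, ← hg, ← hg, ← Matrix.map_mul,
      ← Matrix.map_mul]
    change Ideal.Quotient.mk (Q.relIdeal α) (Q.polyAct α g (MvPolynomial.X x)) = _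
    rw [polyAct, MvPolynomial.aeval_X]
    rfl
  exact congr($h P)

lemma mem_invariants {x : Q.CoordRing α} :
    x ∈ Q.invariants α ↔ ∀ g, Q.ringAct α g x = x := by
  simp [invariants, Algebra.mem_iInf]

/-- An invariant function takes the same value at a representation over `R` and at its transform
by an `R`-point of `∏ GL(αᵢ)`. -/
theorem eval_changeBasis [Infinite k] {R : Type u} [CommRing R] (c : k →+* R)
    (M : ∀ i j, Q.Arr i j → Matrix (Fin (α j)) (Fin (α i)) R)
    (hM : ∀ P ∈ Q.relIdeal α, MvPolynomial.eval₂ c (Q.point M) P = 0)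
    (g : ∀ i, GL (Fin (α i)) R) {P : MvPolynomial (Q.Coord α) k}
    (hP : Ideal.Quotient.mk (Q.relIdeal α) P ∈ Q.invariants α) :
    MvPolynomial.eval₂ c (Q.point (Q.changeBasis g M)) P =
      MvPolynomial.eval₂ c (Q.point M) P := by
  -- A representation over `R` satisfying the relations is a specialization `b` of the universal
  -- one.
  let b : Q.CoordRing α →+* R := Ideal.Quotient.lift (Q.relIdeal α)
    (MvPolynomial.eval₂Hom c (Q.point M)) hM
  have hb : b.comp (algebraMap k (Q.CoordRing α)) = c := by
    ext a
    change MvPolynomial.eval₂Hom c (Q.point M) (MvPolynomial.C a) = c a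
    simp
  have hX : (fun i j a => ((Q.generic α i j a).map (Ideal.Quotient.mk (Q.relIdeal α))).map b) =
      M := by
    funext i j a
    ext p q
    change MvPolynomial.eval₂Hom c (Q.point M) (MvPolynomial.X _) = _
    rw [MvPolynomial.eval₂Hom_X']
    rfl
  have key := Q.eval_changeBasis_of_forall_field
    (fun i j a => (Q.generic α i j a).map (Ideal.Quotient.mk (Q.relIdeal α))) P
    (fun g => by rw [← ringAct_mk, ← mk_eq_eval₂]; exact Q.mem_invariants.mp hP g) b g
  rwa [hb, hX] at key

lemma map_eval₂_pathMatrix {R : Type*} [CommRing R] (c : k →+* R)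
    (M : ∀ i j, Q.Arr i j → Matrix (Fin (α j)) (Fin (α i)) R) {i j : Fin n}
    (π : QPath Q.Arr i j) :
    (pathMatrix (Q.generic α) π).map (MvPolynomial.eval₂Hom c (Q.point M)) = pathMatrix M π := by
  induction π with
  | nil => exact Matrix.map_one _ (map_zero _) (map_one _)
  | cons π a ih =>
    rw [pathMatrix, pathMatrix, Matrix.map_mul, ih]
    congr 1
    ext p q
    simp [generic, point]

lemma map_eval₂_relEntry {R : Type*} [CommRing R] (c : k →+* R)
    (M : ∀ i j, Q.Arr i j → Matrix (Fin (α j)) (Fin (α i)) R) {i j : Fin n}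
    (ρ : QPath Q.Arr i j →₀ k) :
    (Q.relEntry α ρ).map (MvPolynomial.eval₂Hom c (Q.point M)) =
      ρ.sum fun π a => c a • pathMatrix M π := by
  simp_rw [← Q.map_eval₂_pathMatrix c M]
  ext p q
  simp [relEntry, Finsupp.sum, Matrix.sum_apply, MvPolynomial.smul_eq_C_mul]

/-- A combination of cycles at `i` transforms by conjugation. -/
lemma trace_relEntry_mem_invariants {i : Fin n} (ρ : QPath Q.Arr i i →₀ k) :
    Ideal.Quotient.mk (Q.relIdeal α) (Q.relEntry α ρ).trace ∈ Q.invariants α := by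
  rw [mem_invariants]
  intro g
  change Ideal.Quotient.mk (Q.relIdeal α) (Q.polyAct α g (Q.relEntry α ρ).trace) = _
  have h : Q.polyAct α g (Q.relEntry α ρ).trace = ((Q.relEntry α ρ).map (Q.polyAct α g)).trace := by
    simp [Matrix.trace]
  rw [h, polyAct_rel, Matrix.trace_mul_cycle, constMatrix_mul, mul_inv_cancel, constMatrix_one,
    one_mul]

end QuiverWithRelations

/-! ### Matrices of morphisms in local frames. -/

section Frames

variable {V : Scheme.{u}} {L M N : V.Modules} {U W : V.Opens} {r s t : ℕ}

lemma IsFrame.bijective {e : Fin r → Γ(M, U)} (he : IsFrame M U e) :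
    Function.Bijective fun c : Fin r → Γ(V, U) => ∑ p, c p • e p := by
  have h := he U le_rfl
  have h1 : ∀ p, (M.presheaf.map (homOfLE (le_refl U)).op (e p) : Γ(M, U)) = e p := fun p =>
    congr($(M.presheaf.map_id _) (e p))
  simpa only [h1] using h

lemma IsFrame.restrict {e : Fin r → Γ(M, U)} (he : IsFrame M U e) (h : W ≤ U) :
    IsFrame M W fun p => (M.presheaf.map (homOfLE h).op (e p) : Γ(M, W)) := by
  intro W' h'
  have h1 : ∀ p, (M.presheaf.map (homOfLE h').op (M.presheaf.map (homOfLE h).op (e p)) :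
      Γ(M, W')) = M.presheaf.map (homOfLE (h'.trans h)).op (e p) := fun p => by
    rw [← AddCommGrpCat.comp_apply, ← Functor.map_comp]
    rfl
  simpa only [h1] using he W' (h'.trans h)

/-- The morphism `f` is given over `U` by the matrix `A`, whose rows are the coordinates of the
images of the sections `e p`. -/
def HasMatrix (f : M ⟶ N) (e : Fin r → Γ(M, U)) (e' : Fin s → Γ(N, U))
    (A : Matrix (Fin r) (Fin s) Γ(V, U)) : Prop :=
  ∀ p, f.app U (e p) = ∑ q, A p q • e' q

lemma exists_hasMatrix (f : M ⟶ N) (e : Fin r → Γ(M, U)) {e' : Fin s → Γ(N, U)}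
    (he' : IsFrame N U e') : ∃ A, HasMatrix f e e' A := by
  choose A hA using fun p => he'.bijective.2 (f.app U (e p))
  exact ⟨Matrix.of A, fun p => (hA p).symm⟩

lemma HasMatrix.unique {f : M ⟶ N} {e : Fin r → Γ(M, U)} {e' : Fin s → Γ(N, U)}
    {A B : Matrix (Fin r) (Fin s) Γ(V, U)} (hA : HasMatrix f e e' A) (hB : HasMatrix f e e' B)
    (he' : IsFrame N U e') : A = B := by
  funext p
  exact he'.bijective.1 ((hA p).symm.trans (hB p))

lemma hasMatrix_id (e : Fin r → Γ(M, U)) : HasMatrix (𝟙 M) e e 1 := by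
  intro p
  simp [Matrix.one_apply, ite_smul]

lemma hasMatrix_zero (e : Fin r → Γ(M, U)) (e' : Fin s → Γ(N, U)) :
    HasMatrix (0 : M ⟶ N) e e' 0 := by
  intro p
  simp

lemma HasMatrix.add {f g : M ⟶ N} {e : Fin r → Γ(M, U)} {e' : Fin s → Γ(N, U)}
    {A B : Matrix (Fin r) (Fin s) Γ(V, U)} (hA : HasMatrix f e e' A) (hB : HasMatrix g e e' B) :
    HasMatrix (f + g) e e' (A + B) := by
  intro p
  simp only [Matrix.add_apply, add_smul, Finset.sum_add_distrib, ← hA p, ← hB p]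
  rfl

/-- With coordinates in rows, matrices multiply in the order of `≫`, which agrees with the
recursions of `pathMatrix` and `pathHom`. -/
lemma HasMatrix.comp {f : L ⟶ M} {g : M ⟶ N} {e : Fin r → Γ(L, U)} {e' : Fin s → Γ(M, U)}
    {e'' : Fin t → Γ(N, U)} {A : Matrix (Fin r) (Fin s) Γ(V, U)}
    {B : Matrix (Fin s) (Fin t) Γ(V, U)} (hA : HasMatrix f e e' A) (hB : HasMatrix g e' e'' B) :
    HasMatrix (f ≫ g) e e'' (A * B) := by
  intro p
  rw [Scheme.Modules.Hom.comp_app, AddCommGrpCat.comp_apply, hA p, map_sum]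
  simp only [Scheme.Modules.Hom.app_smul, hB _, Finset.smul_sum, smul_smul, Matrix.mul_apply,
    Finset.sum_smul]
  exact Finset.sum_comm

lemma hasMatrix_scalarEnd (c : Γ(V, ⊤)) (e : Fin r → Γ(M, U)) :
    HasMatrix (scalarEnd M c) e e
      ((V.presheaf.map (homOfLE (le_top : U ≤ ⊤)).op c : Γ(V, U)) • 1) := by
  intro p
  rw [scalarEnd_app]
  simp [Matrix.one_apply, ite_smul]

lemma HasMatrix.smul {k : Type u} [Field k] [V.Over (Spec (.of k))] (a : k) {f : M ⟶ N}
    {e : Fin r → Γ(M, U)} {e' : Fin s → Γ(N, U)} {A : Matrix (Fin r) (Fin s) Γ(V, U)}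
    (hA : HasMatrix f e e' A) : HasMatrix (a • f) e e' (constants k V U a • A) := by
  have h := hA.comp (hasMatrix_scalarEnd (constants k V ⊤ a) e')
  rwa [map_constants, Matrix.mul_smul, Matrix.mul_one, ← smul_def] at h

lemma HasMatrix.restrict {f : M ⟶ N} {e : Fin r → Γ(M, U)} {e' : Fin s → Γ(N, U)}
    {A : Matrix (Fin r) (Fin s) Γ(V, U)} (hA : HasMatrix f e e' A) (h : W ≤ U) :
    HasMatrix f (fun p => (M.presheaf.map (homOfLE h).op (e p) : Γ(M, W)))
      (fun q => (N.presheaf.map (homOfLE h).op (e' q) : Γ(N, W)))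
      (A.map (V.presheaf.map (homOfLE h).op).hom) := by
  intro p
  have h1 : f.app W (M.presheaf.map (homOfLE h).op (e p)) =
      N.presheaf.map (homOfLE h).op (f.app U (e p)) :=
    congr($(f.mapPresheaf.naturality (homOfLE h).op) (e p))
  rw [h1, hA p, map_sum]
  simp only [Scheme.Modules.map_smul, Matrix.map_apply]

lemma exists_changeOfFrame {e e' : Fin r → Γ(M, U)} (he : IsFrame M U e) (he' : IsFrame M U e') :
    ∃ g : GL (Fin r) Γ(V, U), HasMatrix (𝟙 M) e e' g.val ∧
      HasMatrix (𝟙 M) e' e (g⁻¹ : GL (Fin r) Γ(V, U)).val := by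
  obtain ⟨A, hA⟩ := exists_hasMatrix (𝟙 M) e he'
  obtain ⟨B, hB⟩ := exists_hasMatrix (𝟙 M) e' he
  have hAB := hA.comp hB
  have hBA := hB.comp hA
  rw [Category.comp_id] at hAB hBA
  exact ⟨⟨A, B, hAB.unique (hasMatrix_id e) he, hBA.unique (hasMatrix_id e') he'⟩, hA, hB⟩

end Frames

/-! ### Evaluation in frames, gluing, and surjectivity. -/

namespace BondalQuiver

variable {k : Type u} [Field k] {V : Scheme.{u}} [V.Over (Spec (.of k))]
  {n : ℕ} {σ : GmAction k V} {E : Fin n → V.Modules} {φ : ∀ i, EquivariantStructure σ (E i)}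
  (Q : BondalQuiver φ) (α : Fin n → ℕ)

/-- Frames of all `Eᵢ` over `U`, and the matrices by which the arrows act. -/
structure Trivialization (U : V.Opens) where
  frame : ∀ i, Fin (α i) → Γ(E i, U)
  isFrame : ∀ i, IsFrame (E i) U (frame i)
  mat : ∀ i j, Q.Arr i j → Matrix (Fin (α j)) (Fin (α i)) Γ(V, U)
  hasMatrix : ∀ i j (a : Q.Arr i j), HasMatrix (Q.hom i j a) (frame j) (frame i) (mat i j a)

namespace Trivialization

variable {Q α} {U W : V.Opens}

/-- Restriction of a trivialization to a smaller open set. -/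
def restrict (D : Q.Trivialization α U) (h : W ≤ U) : Q.Trivialization α W where
  frame i p := (E i).presheaf.map (homOfLE h).op (D.frame i p)
  isFrame i := (D.isFrame i).restrict h
  mat i j a := (D.mat i j a).map (V.presheaf.map (homOfLE h).op).hom
  hasMatrix i j a := (D.hasMatrix i j a).restrict h

lemma hasMatrix_pathHom (D : Q.Trivialization α U) {i j : Fin n} (π : QPath Q.Arr i j) :
    HasMatrix (pathHom Q.hom π) (D.frame j) (D.frame i) (pathMatrix D.mat π) := by
  induction π with
  | nil => exact hasMatrix_id _
  | cons π a ih => exact (D.hasMatrix _ _ a).comp ih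

lemma hasMatrix_linearCombination (D : Q.Trivialization α U) {i j : Fin n}
    (ρ : QPath Q.Arr i j →₀ k) :
    HasMatrix (Finsupp.linearCombination k (pathHom Q.hom) ρ) (D.frame j) (D.frame i)
      (ρ.sum fun π a => constants k V U a • pathMatrix D.mat π) := by
  induction ρ using Finsupp.induction_linear with
  | zero =>
    rw [map_zero, Finsupp.sum_zero_index]
    exact hasMatrix_zero _ _
  | add ρ ρ' h h' =>
    rw [map_add, Finsupp.sum_add_index' (by simp) (by simp [add_smul])]
    exact h.add h'
  | single π a =>
    rw [Finsupp.linearCombination_single, Finsupp.sum_single_index (by simp)]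
    exact (D.hasMatrix_pathHom π).smul a

/-- A relation vanishes as a morphism, and a morphism has only one matrix in given frames. -/
lemma eval₂_eq_zero_of_mem_relIdeal (D : Q.Trivialization α U)
    (P : MvPolynomial (Q.toQuiver.Coord α) k) (hP : P ∈ Q.toQuiver.relIdeal α) :
    MvPolynomial.eval₂ (constants k V U) (Q.toQuiver.point D.mat) P = 0 := by
  suffices h : Q.toQuiver.relIdeal α ≤
      RingHom.ker (MvPolynomial.eval₂Hom (constants k V U) (Q.toQuiver.point D.mat)) from h hP
  rw [QuiverWithRelations.relIdeal, Ideal.span_le]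
  rintro _ ⟨i, j, ρ, p, q, hρ, rfl⟩
  have h := D.hasMatrix_linearCombination ρ
  have hρ' : Finsupp.linearCombination k (pathHom Q.hom) ρ = 0 := hρ
  rw [hρ'] at h
  have h0 := h.unique (hasMatrix_zero _ _) (D.isFrame i)
  have h1 := Q.toQuiver.map_eval₂_relEntry (constants k V U) D.mat ρ
  exact congr($(h1.trans h0) p q)

/-- Evaluation of functions on the space of representations at the matrices of a
trivialization. -/
def eval (D : Q.Trivialization α U) : Q.toQuiver.CoordRing α →+* Γ(V, U) :=
  Ideal.Quotient.lift _ (MvPolynomial.eval₂Hom (constants k V U) (Q.toQuiver.point D.mat))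
    D.eval₂_eq_zero_of_mem_relIdeal

lemma eval_mk (D : Q.Trivialization α U) (P : MvPolynomial (Q.toQuiver.Coord α) k) :
    D.eval (Ideal.Quotient.mk _ P) =
      MvPolynomial.eval₂ (constants k V U) (Q.toQuiver.point D.mat) P := rfl

lemma eval_restrict (D : Q.Trivialization α U) (h : W ≤ U) (x : Q.toQuiver.CoordRing α) :
    (D.restrict h).eval x = V.presheaf.map (homOfLE h).op (D.eval x) := by
  obtain ⟨P, rfl⟩ := Ideal.Quotient.mk_surjective x
  have hc : (V.presheaf.map (homOfLE h).op).hom.comp (constants k V U) = constants k V W :=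
    RingHom.ext fun a => map_constants W U h a
  have := MvPolynomial.hom_eval₂ P (constants k V U) (V.presheaf.map (homOfLE h).op).hom
    (Q.toQuiver.point D.mat)
  rw [hc] at this
  exact this.symm

/-- The change of frame has entries in `Γ(V, U)`, so invariance under constant matrices alone would
not suffice. -/
lemma eval_eq [Infinite k] (D D' : Q.Trivialization α U) {x : Q.toQuiver.CoordRing α}
    (hx : x ∈ Q.toQuiver.invariants α) : D'.eval x = D.eval x := by
  obtain ⟨P, rfl⟩ := Ideal.Quotient.mk_surjective x
  choose g hg hg' using fun i => exists_changeOfFrame (D.isFrame i) (D'.isFrame i)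
  have hmat : D'.mat = Q.toQuiver.changeBasis g D.mat := by
    funext i j a
    have h := ((hg' j).comp (D.hasMatrix i j a)).comp (hg i)
    rw [Category.id_comp, Category.comp_id] at h
    exact (D'.hasMatrix i j a).unique h (D'.isFrame i)
  rw [eval_mk, eval_mk, hmat]
  exact Q.toQuiver.eval_changeBasis _ _ D.eval₂_eq_zero_of_mem_relIdeal g hx

lemma exists_mem (hE : ∀ i, IsVectorBundle (E i) (α i)) (x : V) :
    ∃ U : V.Opens, x ∈ U ∧ Nonempty (Q.Trivialization α U) := by
  choose U e hx he using fun i => hE i x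
  let W : V.Opens := Finset.univ.inf U
  have hW : ∀ i, W ≤ U i := fun i => Finset.inf_le (Finset.mem_univ i)
  have hxW : x ∈ W := by
    rw [← SetLike.mem_coe, Opens.coe_finset_inf]
    simp [hx]
  choose M hM using fun i j (a : Q.Arr i j) => exists_hasMatrix (Q.hom i j a)
    (fun p => ((E j).presheaf.map (homOfLE (hW j)).op (e j p) : Γ(E j, W)))
    ((he i).restrict (hW i))
  exact ⟨W, hxW, ⟨⟨_, fun i => (he i).restrict (hW i), M, hM⟩⟩⟩

lemma le_iSup (hE : ∀ i, IsVectorBundle (E i) (α i)) :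
    (⊤ : V.Opens) ≤ ⨆ D : Σ U, Q.Trivialization α U, D.1 := fun x _ => by
  obtain ⟨U, hx, ⟨D⟩⟩ := exists_mem (Q := Q) hE x
  exact Opens.mem_iSup.mpr ⟨⟨U, D⟩, hx⟩

end Trivialization

variable {α}

lemma section_ext (hE : ∀ i, IsVectorBundle (E i) (α i)) {s t : Γ(V, ⊤)}
    (h : ∀ (U : V.Opens), Q.Trivialization α U →
      (V.presheaf.map (homOfLE (le_top : U ≤ ⊤)).op s : Γ(V, U)) =
        V.presheaf.map (homOfLE (le_top : U ≤ ⊤)).op t) : s = t :=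
  V.sheaf.eq_of_locally_eq' (fun D : Σ U, Q.Trivialization α U => D.1) ⊤
    (fun _ => homOfLE le_top) (Trivialization.le_iSup hE) s t fun D => h D.1 D.2

lemma exists_section [Infinite k] (hE : ∀ i, IsVectorBundle (E i) (α i))
    {x : Q.toQuiver.CoordRing α} (hx : x ∈ Q.toQuiver.invariants α) :
    ∃ s : Γ(V, ⊤), ∀ (U : V.Opens) (D : Q.Trivialization α U),
      V.presheaf.map (homOfLE (le_top : U ≤ ⊤)).op s = D.eval x := by
  obtain ⟨s, hs, -⟩ := V.sheaf.existsUnique_gluing' (fun D : Σ U, Q.Trivialization α U => D.1) ⊤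
    (fun _ => homOfLE le_top) (Trivialization.le_iSup hE) (fun D => D.2.eval x) (by
      intro D D'
      refine (D.2.eval_restrict inf_le_left x).symm.trans ?_
      refine Eq.trans ?_ (D'.2.eval_restrict inf_le_right x)
      exact Trivialization.eval_eq _ _ hx)
  exact ⟨s, fun U D => hs ⟨U, D⟩⟩

lemma isTautologicalPullback_iff (τ : Q.toQuiver.invariants α →+* Γ(V, ⊤)) :
    Q.IsTautologicalPullback α τ ↔ ∀ x (U : V.Opens) (D : Q.Trivialization α U),
      V.presheaf.map (homOfLE (le_top : U ≤ ⊤)).op (τ x) = D.eval x.1 := by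
  constructor
  · rintro h ⟨x, hx⟩ U D
    obtain ⟨P, rfl⟩ := Ideal.Quotient.mk_surjective x
    exact h U D.frame D.isFrame D.mat D.hasMatrix P hx
  · intro h U e he M hM P hP
    exact h ⟨_, hP⟩ U ⟨e, he, M, hM⟩

theorem exists_isTautologicalPullback [Infinite k] (hE : ∀ i, IsVectorBundle (E i) (α i)) :
    ∃ τ : Q.toQuiver.invariants α →+* Γ(V, ⊤), Q.IsTautologicalPullback α τ := by
  choose τ hτ using fun x : Q.toQuiver.invariants α => Q.exists_section hE x.2
  let τ' : Q.toQuiver.invariants α →+* Γ(V, ⊤) :=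
    { toFun := τ
      map_one' := Q.section_ext hE fun U D => by
        simp only [map_one, hτ _ U D]
        exact map_one D.eval
      map_mul' := fun x y => Q.section_ext hE fun U D => by
        simp only [map_mul, hτ _ U D]
        exact map_mul D.eval x.1 y.1
      map_zero' := Q.section_ext hE fun U D => by
        simp only [map_zero, hτ _ U D]
        exact map_zero D.eval
      map_add' := fun x y => Q.section_ext hE fun U D => by
        simp only [map_add, hτ _ U D]
        exact map_add D.eval x.1 y.1 }
  exact ⟨τ', (Q.isTautologicalPullback_iff τ').mpr hτ⟩

theorem surjective_of_isTautologicalPullback [Infinite k] (hV : NearlyProjective σ)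
    (hdecent : Decent φ) (hE : ∀ i, IsVectorBundle (E i) (α i)) (hα : ∃ i, (α i : k) ≠ 0)
    {τ : Q.toQuiver.invariants α →+* Γ(V, ⊤)} (hτ : Q.IsTautologicalPullback α τ) :
    Function.Surjective τ := by
  intro f
  obtain ⟨i, hi⟩ := hα
  have hf : scalarEnd (E i) f ∈ Q.pathSpan i i := Q.pathSpan_eq_top hV hdecent i i ▸ trivial
  obtain ⟨ρ, hρ⟩ := Finsupp.mem_span_range_iff_exists_finsupp.mp hf
  -- In any frame the combination `ρ` of cycles acts by `f • 1`, of trace `αᵢ f`; hence the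
  -- normalization.
  refine ⟨(α i : k)⁻¹ • ⟨_, Q.toQuiver.trace_relEntry_mem_invariants ρ⟩, ?_⟩
  refine Q.section_ext hE fun U D => ?_
  rw [(Q.isTautologicalPullback_iff τ).mp hτ _ U D]
  change D.eval (Ideal.Quotient.mk _ ((α i : k)⁻¹ • (Q.toQuiver.relEntry α ρ).trace)) = _
  have h1 := Q.toQuiver.map_eval₂_relEntry (constants k V U) D.mat ρ
  have h2 := (D.hasMatrix_linearCombination ρ).unique
    (B := (V.presheaf.map (homOfLE (le_top : U ≤ ⊤)).op f : Γ(V, U)) • 1)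
    (by rw [Finsupp.linearCombination_apply, hρ]; exact hasMatrix_scalarEnd f _) (D.isFrame i)
  have h3 := congrArg Matrix.trace (h1.trans h2)
  rw [← AddMonoidHom.map_trace] at h3
  rw [Trivialization.eval_mk, MvPolynomial.smul_eq_C_mul, MvPolynomial.eval₂_mul,
    MvPolynomial.eval₂_C]
  refine (congrArg (constants k V U (α i : k)⁻¹ * ·) h3).trans ?_
  rw [Matrix.trace_smul, Matrix.trace_one, Fintype.card_fin, smul_eq_mul, mul_comm, mul_assoc,
    ← map_natCast (constants k V U), ← map_mul, mul_inv_cancel₀ hi, map_one, mul_one]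

end BondalQuiver

end Bondal

end

theorem proposition2 {k : Type u} [Field k] [IsAlgClosed k]
    {V : Scheme.{u}} [V.Over (Spec (.of k))] (σ : Bondal.GmAction k V)
    (hV : Bondal.NearlyProjective σ)
    {n : ℕ} (E : Fin n → V.Modules) (α : Fin n → ℕ)
    (hE : ∀ i, Bondal.IsVectorBundle (E i) (α i))
    (φ : ∀ i, Bondal.EquivariantStructure σ (E i))
    (hdecent : Bondal.Decent φ)
    (hα : ∃ i, (α i : k) ≠ 0)
    (Q : Bondal.BondalQuiver φ) :
    ∃ τ : Q.toQuiver.invariants α →+* Γ(V, ⊤),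
      Q.IsTautologicalPullback α τ ∧
      (∀ τ', Q.IsTautologicalPullback α τ' → τ' = τ) ∧
      Function.Surjective τ ∧
      IsClosedImmersion (Spec.map (CommRingCat.ofHom τ)) := by
  obtain ⟨τ, hτ⟩ := Q.exists_isTautologicalPullback hE
  have hsurj := Q.surjective_of_isTautologicalPullback hV hdecent hE hα hτ
  refine ⟨τ, hτ, fun τ' hτ' => ?_, hsurj, IsClosedImmersion.spec_of_surjective _ hsurj⟩
  -- Uniqueness: the trivializing open sets cover `V`, and the value of a pullback is prescribed on
  -- each of them.
  refine RingHom.ext fun x => Q.section_ext hE fun U D => ?_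
  rw [(Q.isTautologicalPullback_iff τ').mp hτ' x U D,
    (Q.isTautologicalPullback_iff τ).mp hτ x U D]
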